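/- \textbf{Setting.} A bi-Heyting algebra is a Heyting algebra with a further binary operation $\leftarrow$ such that $a\vee x\ge b$ iff $x\ge a\leftarrow b$ (so $a\leftarrow b$ is the least $x$ with $b\le a\vee x$). Formulas are built from propositional letters $p,q,r,\dots$ with $\bot,\wedge,\vee,\to,\leftarrow$; put $\top=\bot\to\bot$, $\neg\varphi=\varphi\to\bot$, and let ${\sim}\varphi=\varphi\leftarrow\top$ (the least $x$ with $\varphi\vee x=\top$). An algebra validates a formula if every valuation gives it the value $1$. It is complete if every subset has a least upper bound. A variety is a class of bi-Heyting algebras closed under subalgebras, homomorphic images and products, and the variety generated by a class is the least variety containing it. The calculus $\mathsf{HB}$ is the least set of formulas containing the intuitionistic propositional calculus and the axioms $p\to(q\vee(q\leftarrow p))$, $(q\leftarrow p)\to{\sim}(p\to q)$, $(r\leftarrow(q\leftarrow p))\to((q\vee r)\leftarrow p)$, $\neg(q\leftarrow p)\to(p\to q)$, $\neg(p\leftarrow p)$, and closed under substitution, modus ponens and the rule $\varphi/\neg{\sim}\varphi$; $\mathsf{HB}+\Gamma$ is the least such set that also contains $\Gamma$. Put $\beta_0=q\to p$, $\gamma_0=p\to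 q$, $\beta_1=\gamma_0\to(\beta_0\vee q)$, $\gamma_1=\beta_0\to(\gamma_0\vee p)$, and, for $n\ge0$, \[ \beta_{n+2}=\gamma_{n+1}\to(\beta_{n+1}\vee\gamma_n),\quad \gamma_{n+2}=\beta_{n+1}\to(\gamma_{n+1}\vee\beta_n), \] \[ \alpha_n=(\beta_{n+2}\wedge\gamma_{n+2})\to(\beta_{n+1}\vee\gamma_{n+1}),\quad \delta_n=\alpha_n\vee\alpha_{n+1},\quad \varkappa_n=\alpha_{n+1}\to(\alpha_n\vee\beta_{n+2}), \] \[ \mathsf{bb}_2=\bigl[((p\to(q\vee r))\to(q\vee r))\wedge((q\to(p\vee r))\to(p\vee r))\wedge((r\to(p\vee q))\to(p\vee q))\bigr]\to(p\vee q\vee r). \] Let $\mathsf{Sh}=\mathsf{HB}+[(\alpha_0\to\delta_1)\to\delta_0]+\varkappa_0+\mathsf{bb}_2$, and let $\mathcal V(\mathsf{Sh})$ be the variety of all bi-Heyting algebras that validate every formula in $\mathsf{Sh}$. The Fine frame is the poset with distinct points $a_n,b_n,c_n,d_n$ ($n\ge0$) whose order is generated by $b_{n+1}\le b_n$, $c_{n+1}\le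 c_n$, $b_{n+2}\le c_n$, $c_{n+2}\le b_n$, $a_n\le b_{n+1}$, $a_n\le c_{n+1}$, $d_n\le d_{n+1}$, $d_n\le a_n$. Let $X$ be the one-point compactification, with added point $\infty$, of the Fine frame with the discrete topology, ordered by the order of the Fine frame together with $\infty\le b_n$, $\infty\le c_n$ and $d_n\le\infty$ for all $n$. Let $\mathfrak A$ be the bi-Heyting algebra of clopen upsets of $X$, and let $\mathcal V(\mathsf F)$ be the variety of bi-Heyting algebras generated by $\mathfrak A$. \textbf{Theorem.} $\mathcal V(\mathsf F)\subseteq\mathcal V(\mathsf{Sh})$, and no variety $\mathcal V$ of bi-Heyting algebras with $\mathcal V(\mathsf F)\subseteq\mathcal V\subseteq\mathcal V(\mathsf{Sh})$ is generated by its complete members. Moreover, every complete algebra in $\mathcal V(\mathsf{Sh})$ validates $\delta_0$, while $\mathfrak A$ lies in $\mathcal V(\mathsf F)$ and refutes $\delta_0$. -/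

import Mathlib

universe u

namespace HeytingBrouwer

/-! ### Formulas, the Heyting-Brouwer calculus, and its extensions -/

/-- Formulas of the language of `HB`; the propositional letters are indexed by `ℕ`.
`coimp φ ψ` is the coimplication `φ ← ψ`, read in an algebra as the least `x` such that
`ψ ≤ φ ⊔ x`, that is, as `ψ \ φ`. -/
inductive Form : Type
  | var (n : ℕ)
  | bot
  | and (φ ψ : Form)
  | or (φ ψ : Form)
  | imp (φ ψ : Form)
  | coimp (φ ψ : Form)

namespace Form

/-- `⊤ := ⊥ → ⊥`. -/
def top : Form := imp bot bot

/-- `¬φ := φ → ⊥`. -/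
def neg (φ : Form) : Form := imp φ bot

/-- The dual negation `∼φ`, which is read in an algebra as `⊤ \ φ`, the least `x` such that
`φ ⊔ x = ⊤`. -/
def coneg (φ : Form) : Form := coimp φ top

/-- Uniform substitution. -/
def subst (σ : ℕ → Form) : Form → Form
  | var n => σ n
  | bot => bot
  | and φ ψ => and (subst σ φ) (subst σ ψ)
  | or φ ψ => or (subst σ φ) (subst σ ψ)
  | imp φ ψ => imp (subst σ φ) (subst σ ψ)
  | coimp φ ψ => coimp (subst σ φ) (subst σ ψ)

/-- The value of a formula in a bi-Heyting algebra under a valuation of the letters. -/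
def eval {α : Type u} [BiheytingAlgebra α] (v : ℕ → α) : Form → α
  | var n => v n
  | bot => ⊥
  | and φ ψ => eval v φ ⊓ eval v ψ
  | or φ ψ => eval v φ ⊔ eval v ψ
  | imp φ ψ => eval v φ ⇨ eval v ψ
  | coimp φ ψ => eval v ψ \ eval v φ

/-- The propositional letter `p`. -/
def p : Form := var 0

/-- The propositional letter `q`. -/
def q : Form := var 1

/-- The propositional letter `r`. -/
def r : Form := var 2

end Form

open Form in
/-- A Hilbert-style axiomatization of the intuitionistic propositional calculus, to be closed
under substitution and modus ponens. -/
def ipcAxioms : Set Form :=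
  { imp p (imp q p),
    imp (imp p (imp q r)) (imp (imp p q) (imp p r)),
    imp (and p q) p,
    imp (and p q) q,
    imp p (imp q (and p q)),
    imp p (or p q),
    imp q (or p q),
    imp (imp p r) (imp (imp q r) (imp (or p q) r)),
    imp bot p }

open Form in
/-- The axioms for coimplication:
`p → (q ∨ (q ← p))`, `(q ← p) → ∼(p → q)`, `(r ← (q ← p)) → ((q ∨ r) ← p)`,
`¬(q ← p) → (p → q)` and `¬(p ← p)`. -/
def coimpAxioms : Set Form :=
  { imp p (or q (coimp q p)),
    imp (coimp q p) (coneg (imp p q)),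
    imp (coimp r (coimp q p)) (coimp (or q r) p),
    imp (neg (coimp q p)) (imp p q),
    neg (coimp p p) }

/-- `Derivable Γ` is the logic `HB + Γ`: the least set of formulas that contains the axioms of
the Heyting-Brouwer calculus and the formulas in `Γ`, and is closed under substitution, modus
ponens, and the rule from `φ` infer `¬∼φ`. -/
inductive Derivable (Γ : Set Form) : Form → Prop
  | ipc {φ : Form} : φ ∈ ipcAxioms → Derivable Γ φ
  | hb {φ : Form} : φ ∈ coimpAxioms → Derivable Γ φ
  | ax {φ : Form} : φ ∈ Γ → Derivable Γ φ
  | subst {φ : Form} (σ : ℕ → Form) : Derivable Γ φ → Derivable Γ (φ.subst σ)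
  | mp {φ ψ : Form} : Derivable Γ (φ.imp ψ) → Derivable Γ φ → Derivable Γ ψ
  | nec {φ : Form} : Derivable Γ φ → Derivable Γ φ.coneg.neg

/-! ### The Shehtman logic over `HB` -/

namespace Form

/-- The pair `(βₙ, γₙ)`. -/
def betaGamma : ℕ → Form × Form
  | 0 => (imp q p, imp p q)
  | 1 => (imp (imp p q) (or (imp q p) q), imp (imp q p) (or (imp p q) p))
  | n + 2 =>
    (imp (betaGamma (n + 1)).2 (or (betaGamma (n + 1)).1 (betaGamma n).2),
      imp (betaGamma (n + 1)).1 (or (betaGamma (n + 1)).2 (betaGamma n).1))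

/-- `β₀ = q → p`, `β₁ = γ₀ → (β₀ ∨ q)`, `βₙ₊₂ = γₙ₊₁ → (βₙ₊₁ ∨ γₙ)`. -/
def beta (n : ℕ) : Form := (betaGamma n).1

/-- `γ₀ = p → q`, `γ₁ = β₀ → (γ₀ ∨ p)`, `γₙ₊₂ = βₙ₊₁ → (γₙ₊₁ ∨ βₙ)`. -/
def gamma (n : ℕ) : Form := (betaGamma n).2

/-- `αₙ = (βₙ₊₂ ∧ γₙ₊₂) → (βₙ₊₁ ∨ γₙ₊₁)`. -/
def alpha (n : ℕ) : Form :=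
  imp (and (beta (n + 2)) (gamma (n + 2))) (or (beta (n + 1)) (gamma (n + 1)))

/-- `δₙ = αₙ ∨ αₙ₊₁`. -/
def delta (n : ℕ) : Form := or (alpha n) (alpha (n + 1))

/-- `ϰₙ = αₙ₊₁ → (αₙ ∨ βₙ₊₂)`. -/
def kappa (n : ℕ) : Form := imp (alpha (n + 1)) (or (alpha n) (beta (n + 2)))

/-- The Gabbay-de Jongh formula `bb₂`. -/
def bb2 : Form :=
  imp
    (and (and
      (imp (imp p (or q r)) (or q r))
      (imp (imp q (or p r)) (or p r)))
      (imp (imp r (or p q)) (or p q)))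
    (or (or p q) r)

end Form

open Form in
/-- The Shehtman logic over `HB`: `Sh = HB + [(α₀ → δ₁) → δ₀] + ϰ₀ + bb₂`. -/
def shehtmanLogic : Set Form :=
  { φ | Derivable {imp (imp (alpha 0) (delta 1)) (delta 0), kappa 0, bb2} φ }

/-! ### Varieties of bi-Heyting algebras -/

/-- Bi-Heyting algebras in the universe `u`. -/
structure BHAlg : Type (u + 1) where
  carrier : Type u
  [str : BiheytingAlgebra carrier]

instance : CoeSort BHAlg.{u} (Type u) := ⟨BHAlg.carrier⟩

attribute [instance] BHAlg.str

namespace BHAlg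

/-- `A ⊨ φ`: every valuation in `A` sends `φ` to `⊤`. -/
def Validates (A : BHAlg.{u}) (φ : Form) : Prop :=
  ∀ v : ℕ → A, φ.eval v = ⊤

/-- `A` is complete: every subset of `A` has a least upper bound (equivalently, every subset
has a greatest lower bound). -/
def IsComplete (A : BHAlg.{u}) : Prop :=
  ∀ s : Set A, ∃ a : A, IsLUB s a

end BHAlg

/-- A class of bi-Heyting algebras is a variety if it is closed under (isomorphic copies of)
subalgebras, homomorphic images, and products. -/
structure IsVariety (V : Set BHAlg.{u}) : Prop where
  sub : ∀ A ∈ V, ∀ (B : BHAlg.{u}) (f : BiheytingHom B A), Function.Injective f → B ∈ V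
  image : ∀ A ∈ V, ∀ (B : BHAlg.{u}) (f : BiheytingHom A B), Function.Surjective f → B ∈ V
  prod : ∀ (I : Type u) (A : I → BHAlg.{u}), (∀ i, A i ∈ V) → BHAlg.mk (∀ i, A i) ∈ V

/-- The variety generated by a class `K`: the least variety containing `K`. -/
def generatedVariety (K : Set BHAlg.{u}) : Set BHAlg.{u} :=
  { A | ∀ V : Set BHAlg.{u}, IsVariety V → K ⊆ V → A ∈ V }

/-- The variety `V(L)` of algebraic models of a set `L` of formulas. -/
def modelsOf (L : Set Form) : Set BHAlg.{u} :=
  { A | ∀ φ ∈ L, A.Validates φ }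

/-- `V(Sh)`. -/
def shehtmanVariety : Set BHAlg.{u} := modelsOf shehtmanLogic

/-! ### The Fine frame, its compactification, and the algebra of clopen upsets -/

/-- The points of the Fine frame. -/
inductive FineFrame : Type u
  | a (n : ℕ)
  | b (n : ℕ)
  | c (n : ℕ)
  | d (n : ℕ)

namespace FineFrame

/-- The order of the Fine frame. See `le_iff_reflTransGen` for the description by edges. -/
def le : FineFrame.{u} → FineFrame.{u} → Prop
  | b i, b j => j ≤ i
  | c i, c j => j ≤ i
  | b i, c j => j + 2 ≤ i
  | c i, b j => j + 2 ≤ i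
  | a i, a j => i = j
  | a i, b j => j ≤ i + 1
  | a i, c j => j ≤ i + 1
  | d i, d j => i ≤ j
  | d i, a j => i ≤ j
  | d _, b _ => True
  | d _, c _ => True
  | _, _ => False

instance : PartialOrder FineFrame.{u} where
  le := le
  le_refl x := by cases x <;> simp [le]
  le_trans x y z := by
    cases x <;> cases y <;> cases z <;> simp only [le] <;> grind
  le_antisymm x y := by
    cases x <;> cases y <;> simp only [le] <;> grind

/-- The edges in the picture of the Fine frame, the lower point first. -/
inductive Edge : FineFrame.{u} → FineFrame.{u} → Prop
  | bb (n : ℕ) : Edge (b (n + 1)) (b n)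
  | cc (n : ℕ) : Edge (c (n + 1)) (c n)
  | bc (n : ℕ) : Edge (b (n + 2)) (c n)
  | cb (n : ℕ) : Edge (c (n + 2)) (b n)
  | ab (n : ℕ) : Edge (a n) (b (n + 1))
  | ac (n : ℕ) : Edge (a n) (c (n + 1))
  | dd (n : ℕ) : Edge (d n) (d (n + 1))
  | da (n : ℕ) : Edge (d n) (a n)

instance : TopologicalSpace FineFrame.{u} := ⊥

instance : DiscreteTopology FineFrame.{u} := ⟨rfl⟩

/-- The index of a point. -/
def index : FineFrame.{u} → ℕ
  | a n => n
  | b n => n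
  | c n => n
  | d n => n

theorem finite_index_le (N : ℕ) : {x : FineFrame.{u} | x.index ≤ N}.Finite := by
  have h : {x : FineFrame.{u} | x.index ≤ N} ⊆
      (a '' Set.Iic N ∪ b '' Set.Iic N) ∪ (c '' Set.Iic N ∪ d '' Set.Iic N) := by
    intro x hx
    cases x <;> simpa [index] using hx
  exact Set.Finite.subset
    ((((Set.finite_Iic N).image _).union ((Set.finite_Iic N).image _)).union
      (((Set.finite_Iic N).image _).union ((Set.finite_Iic N).image _))) h

theorem exists_index_le {S : Set FineFrame.{u}} (hS : S.Finite) :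
    ∃ N, ∀ x ∈ S, x.index ≤ N := by
  obtain ⟨N, hN⟩ := (hS.image index).bddAbove
  exact ⟨N, fun x hx => hN ⟨x, hx, rfl⟩⟩

theorem le_iff_reflTransGen (x y : FineFrame.{u}) :
    x ≤ y ↔ Relation.ReflTransGen Edge x y := by
  have hbb : ∀ i k, Relation.ReflTransGen Edge.{u} (b (i + k)) (b i) := by
    intro i k
    induction k with
    | zero => exact .refl
    | succ k ih => exact .head (.bb (i + k)) ih
  have hcc : ∀ i k, Relation.ReflTransGen Edge.{u} (c (i + k)) (c i) := by
    intro i k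
    induction k with
    | zero => exact .refl
    | succ k ih => exact .head (.cc (i + k)) ih
  have hdd : ∀ i k, Relation.ReflTransGen Edge.{u} (d i) (d (i + k)) := by
    intro i k
    induction k with
    | zero => exact .refl
    | succ k ih => exact .tail ih (.dd (i + k))
  have hab : ∀ i j, j ≤ i + 1 → Relation.ReflTransGen Edge.{u} (a i) (b j) := by
    intro i j h
    obtain ⟨k, hk⟩ := Nat.exists_eq_add_of_le h
    exact .head (.ab i) (hk ▸ hbb j k)
  have hac : ∀ i j, j ≤ i + 1 → Relation.ReflTransGen Edge.{u} (a i) (c j) := by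
    intro i j h
    obtain ⟨k, hk⟩ := Nat.exists_eq_add_of_le h
    exact .head (.ac i) (hk ▸ hcc j k)
  have hda : ∀ i j, i ≤ j → Relation.ReflTransGen Edge.{u} (d i) (a j) := by
    intro i j h
    obtain ⟨k, rfl⟩ := Nat.exists_eq_add_of_le h
    exact .tail (hdd i k) (.da _)
  constructor
  · intro h
    change le x y at h
    cases x with
    | a i =>
      cases y with
      | a j => simp only [le] at h; subst h; exact .refl
      | b j => exact hab i j h
      | c j => exact hac i j h
      | d j => exact h.elim
    | b i =>
      cases y with
      | a j => exact h.elim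
      | b j => obtain ⟨k, rfl⟩ := Nat.exists_eq_add_of_le (show j ≤ i from h); exact hbb j k
      | c j =>
        obtain ⟨k, rfl⟩ := Nat.exists_eq_add_of_le (show j + 2 ≤ i from h)
        exact .tail (hbb (j + 2) k) (.bc j)
      | d j => exact h.elim
    | c i =>
      cases y with
      | a j => exact h.elim
      | b j =>
        obtain ⟨k, rfl⟩ := Nat.exists_eq_add_of_le (show j + 2 ≤ i from h)
        exact .tail (hcc (j + 2) k) (.cb j)
      | c j => obtain ⟨k, rfl⟩ := Nat.exists_eq_add_of_le (show j ≤ i from h); exact hcc j k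
      | d j => exact h.elim
    | d i =>
      cases y with
      | a j => exact hda i j h
      | b j => exact (hda i (i + j) (by omega)).trans (hab _ _ (by omega))
      | c j => exact (hda i (i + j) (by omega)).trans (hac _ _ (by omega))
      | d j => obtain ⟨k, rfl⟩ := Nat.exists_eq_add_of_le (show i ≤ j from h); exact hdd i k
  · intro h
    induction h with
    | refl => exact le_refl x
    | tail _ e ih =>
      refine le_trans ih ?_
      cases e with
      | bb n => exact Nat.le_succ n
      | cc n => exact Nat.le_succ n
      | bc n => exact le_refl (n + 2)
      | cb n => exact le_refl (n + 2)
      | ab n => exact le_refl (n + 1)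
      | ac n => exact le_refl (n + 1)
      | dd n => exact Nat.le_succ n
      | da n => exact le_refl n

end FineFrame

open OnePoint

/-- The space `X_F`: the one-point compactification of the (discrete) Fine frame. -/
abbrev FineSpace : Type u := OnePoint FineFrame.{u}

namespace FineSpace

/-- The order of the Fine frame, extended by `∞ ≤ bᵢ`, `∞ ≤ cᵢ` and `dᵢ ≤ ∞`. -/
def le : FineSpace.{u} → FineSpace.{u} → Prop
  | OnePoint.some x, OnePoint.some y => x ≤ y
  | ∞, ∞ => True
  | ∞, OnePoint.some (.b _) => True
  | ∞, OnePoint.some (.c _) => True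
  | OnePoint.some (.d _), ∞ => True
  | _, _ => False

instance : PartialOrder FineSpace.{u} where
  le := le
  le_refl x := by
    rcases x with _ | x
    · trivial
    · exact le_refl x
  le_trans x y z := by
    rcases x with _ | _ | _ | _ | _ <;> rcases y with _ | _ | _ | _ | _ <;>
      rcases z with _ | _ | _ | _ | _ <;> simp only [le, LE.le, FineFrame.le] <;> grind
  le_antisymm x y hxy hyx := by
    rcases x with _ | x <;> rcases y with _ | y
    · rfl
    · cases y <;> first | exact hxy.elim | exact hyx.elim
    · cases x <;> first | exact hxy.elim | exact hyx.elim
    · exact congrArg _ (le_antisymm (α := FineFrame) hxy hyx)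

theorem isClopen_iff (S : Set FineSpace.{u}) :
    IsClopen S ↔
      (∞ ∈ S → ∃ N, ∀ x : FineFrame.{u}, N < x.index → (x : FineSpace.{u}) ∈ S) ∧
      (∞ ∉ S → ∃ N, ∀ x : FineFrame.{u}, (x : FineSpace.{u}) ∈ S → x.index ≤ N) := by
  have key : ∀ T : Set FineFrame.{u}, IsCompact T ↔ ∃ N, ∀ x ∈ T, x.index ≤ N := by
    intro T
    rw [isCompact_iff_finite]
    exact ⟨FineFrame.exists_index_le, fun ⟨N, hN⟩ => (FineFrame.finite_index_le N).subset hN⟩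
  by_cases h : ∞ ∈ S
  · have h' : ∞ ∉ Sᶜ := fun hc => hc h
    rw [IsClopen, isClosed_iff_of_mem h, isOpen_iff_of_mem' h, key]
    simp only [isClosed_discrete, isOpen_discrete, true_and, and_true, h, true_implies,
      not_true_eq_false, false_implies]
    refine exists_congr fun N => forall_congr' fun x => ?_
    rw [← not_imp_not, not_le]
    simp
  · rw [IsClopen, isClosed_iff_of_notMem h, isOpen_iff_of_notMem h, key]
    simp [h]

/-- The down-closure of a clopen set is clopen. -/
theorem isClopen_lowerClosure {S : Set FineSpace.{u}} (hS : IsClopen S) :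
    IsClopen (lowerClosure S : Set FineSpace.{u}) := by
  obtain ⟨h1, h2⟩ := (isClopen_iff S).1 hS
  rw [isClopen_iff]
  simp only [SetLike.mem_coe, mem_lowerClosure]
  by_cases hbc : ∃ n, ((FineFrame.b n : FineFrame.{u}) : FineSpace.{u}) ∈ S ∨
      ((FineFrame.c n : FineFrame.{u}) : FineSpace.{u}) ∈ S
  · obtain ⟨n, hn⟩ := hbc
    refine ⟨fun _ => ⟨n + 2, fun x hx => ?_⟩, fun h => (h ?_).elim⟩
    · rcases hn with hn | hn <;> refine ⟨_, hn, ?_⟩ <;> cases x <;>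
        simp only [FineFrame.index] at hx
      · show n ≤ _ + 1
        omega
      · show n ≤ _
        omega
      · show n + 2 ≤ _
        omega
      · trivial
      · show n ≤ _ + 1
        omega
      · show n + 2 ≤ _
        omega
      · show n ≤ _
        omega
      · trivial
    · rcases hn with hn | hn <;> exact ⟨_, hn, trivial⟩
  · push Not at hbc
    have hi : ∞ ∉ S := by
      intro h
      obtain ⟨N, hN⟩ := h1 h
      exact (hbc (N + 1)).1 (hN (.b (N + 1)) (Nat.lt_succ_self N))
    obtain ⟨N, hN⟩ := h2 hi
    refine ⟨?_, fun _ => ⟨N, ?_⟩⟩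
    · rintro ⟨y, hy, hle⟩
      rcases y with _ | n | n | n | n
      · exact (hi hy).elim
      · exact hle.elim
      · exact ((hbc n).1 hy).elim
      · exact ((hbc n).2 hy).elim
      · exact hle.elim
    · rintro x ⟨y, hy, hle⟩
      rcases y with _ | n | n | n | n
      · exact (hi hy).elim
      · have hn : n ≤ N := hN _ hy
        cases x with
        | a m => exact (show m = n from hle).trans_le hn
        | b m => exact hle.elim
        | c m => exact hle.elim
        | d m => exact (show m ≤ n from hle).trans hn
      · exact ((hbc n).1 hy).elim
      · exact ((hbc n).2 hy).elim
      · have hn : n ≤ N := hN _ hy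
        cases x with
        | a m => exact hle.elim
        | b m => exact hle.elim
        | c m => exact hle.elim
        | d m => exact (show m ≤ n from hle).trans hn

/-- The up-closure of a clopen set is clopen. -/
theorem isClopen_upperClosure {S : Set FineSpace.{u}} (hS : IsClopen S) :
    IsClopen (upperClosure S : Set FineSpace.{u}) := by
  obtain ⟨h1, h2⟩ := (isClopen_iff S).1 hS
  rw [isClopen_iff]
  simp only [SetLike.mem_coe, mem_upperClosure]
  by_cases hd : ∃ n, ((FineFrame.d n : FineFrame.{u}) : FineSpace.{u}) ∈ S
  · obtain ⟨n, hn⟩ := hd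
    refine ⟨fun _ => ⟨n, fun x hx => ⟨_, hn, ?_⟩⟩, fun h => (h ⟨_, hn, trivial⟩).elim⟩
    cases x with
    | a m => exact Nat.le_of_lt hx
    | b m => trivial
    | c m => trivial
    | d m => exact Nat.le_of_lt hx
  · push Not at hd
    have hi : ∞ ∉ S := by
      intro h
      obtain ⟨N, hN⟩ := h1 h
      exact hd (N + 1) (hN (.d (N + 1)) (Nat.lt_succ_self N))
    obtain ⟨N, hN⟩ := h2 hi
    refine ⟨?_, fun _ => ⟨N + 1, ?_⟩⟩
    · rintro ⟨y, hy, hle⟩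
      rcases y with _ | n | n | n | n
      · exact (hi hy).elim
      · exact hle.elim
      · exact hle.elim
      · exact hle.elim
      · exact (hd n hy).elim
    · rintro x ⟨y, hy, hle⟩
      rcases y with _ | y
      · exact (hi hy).elim
      · have hn : y.index ≤ N := hN y hy
        change FineFrame.le y x at hle
        have hd' : ∀ n, y ≠ .d n := fun n e => hd n (e ▸ hy)
        cases y <;> cases x <;> simp only [FineFrame.le, FineFrame.index] at * <;>
          first | omega | exact (hd' _ rfl).elim

/-- The implication `U → V = X \ ↓(U \ V)` of clopen upsets. -/
def himp (U V : ClopenUpperSet FineSpace.{u}) : ClopenUpperSet FineSpace.{u} where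
  carrier := (lowerClosure ((U : Set FineSpace.{u}) \ V) : Set FineSpace.{u})ᶜ
  isClopen' := (isClopen_lowerClosure (U.isClopen.diff V.isClopen)).compl
  upper' := (lowerClosure ((U : Set FineSpace.{u}) \ V)).lower.compl

/-- The coimplication `V ← U = ↑(U \ V)` of clopen upsets. -/
def sdiff (U V : ClopenUpperSet FineSpace.{u}) : ClopenUpperSet FineSpace.{u} where
  carrier := (upperClosure ((U : Set FineSpace.{u}) \ V) : Set FineSpace.{u})
  isClopen' := isClopen_upperClosure (U.isClopen.diff V.isClopen)
  upper' := (upperClosure ((U : Set FineSpace.{u}) \ V)).upper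

theorem le_himp_iff (U V W : ClopenUpperSet FineSpace.{u}) : U ≤ himp V W ↔ U ⊓ V ≤ W := by
  constructor
  · rintro h x ⟨hU, hV⟩
    by_contra hW
    exact h hU ⟨x, ⟨hV, hW⟩, le_refl x⟩
  · rintro h x hU ⟨y, ⟨hV, hW⟩, hxy⟩
    exact hW (h ⟨U.upper hxy hU, hV⟩)

theorem sdiff_le_iff (U V W : ClopenUpperSet FineSpace.{u}) : sdiff U V ≤ W ↔ U ≤ V ⊔ W := by
  constructor
  · intro h x hU
    by_cases hV : x ∈ V
    · exact Or.inl hV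
    · exact Or.inr (h ⟨x, ⟨hU, hV⟩, le_refl x⟩)
  · rintro h x ⟨y, ⟨hU, hV⟩, hyx⟩
    exact W.upper hyx ((h hU).resolve_left hV)

instance : BiheytingAlgebra (ClopenUpperSet FineSpace.{u}) where
  himp := himp
  le_himp_iff := le_himp_iff
  compl U := himp U ⊥
  himp_bot _ := rfl
  sdiff := sdiff
  sdiff_le_iff := sdiff_le_iff
  hnot U := sdiff ⊤ U
  top_sdiff _ := rfl
  le_top _ := le_top
  bot_le _ := bot_le

end FineSpace

/-- The bi-Heyting algebra `𝔄` of clopen upsets of `X_F`. -/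
def fineAlgebra : BHAlg.{u} := ⟨ClopenUpperSet FineSpace.{u}⟩

/-- `V(F)`: the variety of bi-Heyting algebras generated by `𝔄`. -/
def fineVariety : Set BHAlg.{u} := generatedVariety {fineAlgebra}

end HeytingBrouwer

namespace HeytingBrouwer

/-! ### Soundness of the calculus and varieties of models -/

/-! The formula `δ₀` separates complete algebras from `𝔄`. In a complete bi-Heyting algebra `a ⊔ ·`
has the left adjoint `· \ a`, so joins distribute over arbitrary meets. Let `Pᵢ` (`i < 3`) be the
meet of all `δₖ` and of all `αₘ` with `m ≢ i` mod 3. Distributivity, the decrease of `δₙ` and the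
shifts of `ϰ₀` give `(Pᵢ → Pⱼ ∨ Pₖ) ≤ Pⱼ ∨ Pₖ`. Hence `bb₂` yields `P₀ ∨ P₁ ∨ P₂ = ⊤`, and each `Pᵢ`
lies below `δ₀` (`alpha_sup_alpha_eq_top`).

In `𝔄`, a failure of `α₀` forces the values of `p`, `q` into a single configuration
(`exists_isFinePair`), in which `αₖ` fails exactly below `aₙ₊ₖ` (`IsFinePair.mem_eval_alpha`); the
first two axioms can then be read off the order. `bb₂` holds because a maximal point outside a
clopen upset is never `∞`, and every other point has at most two covers. Yet `δ₀` fails at `d₀`,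
which lies below both `a₀` and `a₁`.

The models of `δ₀` form a variety, so a subvariety of `V(Sh)` generated by its complete members
validates `δ₀` and cannot contain `𝔄`. -/

theorem Form.eval_subst {α : Type u} [BiheytingAlgebra α] (v : ℕ → α) (σ : ℕ → Form) (φ : Form) :
    (φ.subst σ).eval v = φ.eval (fun n => (σ n).eval v) := by
  induction φ <;> simp_all [Form.subst, Form.eval]

theorem validates_of_mem_ipcAxioms (A : BHAlg.{u}) {φ : Form} (h : φ ∈ ipcAxioms) :
    A.Validates φ := by
  intro v
  simp only [ipcAxioms, Set.mem_insert_iff, Set.mem_singleton_iff] at h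
  rcases h with rfl | rfl | rfl | rfl | rfl | rfl | rfl | rfl | rfl <;>
    simp only [Form.eval, Form.p, Form.q, Form.r, himp_eq_top_iff, le_himp_iff]
  · exact inf_le_left
  · have h1 : (v 0 ⇨ v 1 ⇨ v 2) ⊓ (v 0 ⇨ v 1) ⊓ v 0 ≤ v 0 := inf_le_right
    have h2 : (v 0 ⇨ v 1 ⇨ v 2) ⊓ (v 0 ⇨ v 1) ⊓ v 0 ≤ v 1 :=
      (inf_le_inf_right _ inf_le_right).trans himp_inf_le
    have h3 : (v 0 ⇨ v 1 ⇨ v 2) ⊓ (v 0 ⇨ v 1) ⊓ v 0 ≤ v 1 ⇨ v 2 :=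
      (inf_le_inf_right _ inf_le_left).trans himp_inf_le
    exact (le_inf h3 h2).trans himp_inf_le
  · exact inf_le_left
  · exact inf_le_right
  · exact le_rfl
  · exact le_sup_left
  · exact le_sup_right
  · rw [inf_sup_left]
    refine sup_le ?_ ?_
    · exact (inf_le_inf_right _ inf_le_left).trans himp_inf_le
    · exact (inf_le_inf_right _ inf_le_right).trans himp_inf_le
  · exact bot_le

theorem validates_of_mem_coimpAxioms (A : BHAlg.{u}) {φ : Form} (h : φ ∈ coimpAxioms) :
    A.Validates φ := by
  intro v
  simp only [coimpAxioms, Set.mem_insert_iff, Set.mem_singleton_iff] at h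
  rcases h with rfl | rfl | rfl | rfl | rfl <;>
    simp only [Form.eval, Form.p, Form.q, Form.r, Form.neg, Form.coneg, Form.top,
      himp_eq_top_iff, le_himp_iff, himp_self, sdiff_self, top_sdiff', himp_bot]
  · exact le_sup_sdiff
  · rw [sdiff_le_iff]
    calc v 0 ≤ v 0 ⊓ ((v 0 ⇨ v 1) ⊔ ￢(v 0 ⇨ v 1)) := by simp
      _ ≤ v 1 ⊔ ￢(v 0 ⇨ v 1) := by
        rw [inf_sup_left]
        exact sup_le_sup inf_himp_le inf_le_right
  · rw [sdiff_sdiff]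
  · calc (v 0 \ v 1)ᶜ ⊓ v 0 ≤ (v 0 \ v 1)ᶜ ⊓ (v 1 ⊔ v 0 \ v 1) :=
          inf_le_inf_left _ le_sup_sdiff
      _ ≤ v 1 := by
        rw [inf_sup_left, compl_inf_self, sup_bot_eq]
        exact inf_le_right

/-- Every derivable formula holds in every algebra that validates the axioms. -/
theorem Derivable.validates {Γ : Set Form} {A : BHAlg.{u}} (hΓ : ∀ φ ∈ Γ, A.Validates φ)
    {φ : Form} (h : Derivable Γ φ) : A.Validates φ := by
  induction h with
  | ipc h => exact validates_of_mem_ipcAxioms A h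
  | hb h => exact validates_of_mem_coimpAxioms A h
  | ax h => exact hΓ _ h
  | subst σ _ ih => intro v; rw [Form.eval_subst]; exact ih _
  | mp _ _ ih₁ ih₂ =>
    intro v
    have h₁ := ih₁ v
    rwa [Form.eval, ih₂ v, top_himp] at h₁
  | nec _ ih => intro v; simp [Form.neg, Form.coneg, Form.top, Form.eval, ih v]

theorem Form.map_eval {α β : Type u} [BiheytingAlgebra α] [BiheytingAlgebra β]
    (f : BiheytingHom α β) (v : ℕ → α) (φ : Form) :
    f (φ.eval v) = φ.eval (fun n => f (v n)) := by
  induction φ <;> simp_all [Form.eval]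

theorem Form.eval_pi {I : Type u} {A : I → Type u} [∀ i, BiheytingAlgebra (A i)]
    (v : ℕ → ∀ i, A i) (φ : Form) (i : I) :
    φ.eval v i = φ.eval (fun n => v n i) := by
  induction φ <;> simp_all [Form.eval]

/-- Reduces validity throughout a generated variety to validity in its generators. -/
theorem isVariety_modelsOf (L : Set Form) : IsVariety (modelsOf.{u} L) where
  sub A hA B f hf φ hφ v := hf <| by
    rw [Form.map_eval, hA φ hφ, map_top]
  image A hA B f hf φ hφ v := by
    choose g hg using hf
    have h := congrArg f (hA φ hφ (fun n => g (v n)))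
    simpa [Form.map_eval, hg] using h
  prod I A hA φ hφ v := by
    funext i
    exact (Form.eval_pi v φ i).trans (hA i φ hφ _)

/-! ### Complete models of the Shehtman logic -/

section Complete

variable {α : Type u} [BiheytingAlgebra α] {b g A : ℕ → α}

theorem beta_le_alpha (hb : Monotone b)
    (hA : ∀ n, A n = (b (n + 2) ⊓ g (n + 2)) ⇨ (b (n + 1) ⊔ g (n + 1)))
    {n m : ℕ} (h : n ≤ m + 1) : b n ≤ A m := by
  rw [hA, le_himp_iff]
  exact inf_le_left.trans ((hb h).trans le_sup_left)

/-- `βₙ` implies every `αₘ` of large index, hence some late `δₘ`, and the `δ`'s only grow as the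
index decreases. -/
theorem beta_le_delta (hb : Monotone b)
    (hA : ∀ n, A n = (b (n + 2) ⊓ g (n + 2)) ⇨ (b (n + 1) ⊔ g (n + 1)))
    (hD : Antitone fun n => A n ⊔ A (n + 1)) (n k : ℕ) : b n ≤ A k ⊔ A (k + 1) :=
  (beta_le_alpha hb hA (show n ≤ n + k + 1 by omega)).trans
    (le_sup_left.trans (hD (show k ≤ n + k by omega)))

/-- Thus `(βₙ₊₂ ∧ γₙ₊₂) \ (βₙ₊₁ ∨ γₙ₊₁)`, the obstruction to `αₙ`, lies below every other `αₘ`. For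
`m > n` already `βₙ₊₂ ≤ αₘ`. For `m + 1 = n` use `δₘ`, whose disjunct `αₙ` is absorbed; larger gaps
descend through `ϰ`. -/
theorem beta_inf_gamma_le (hb : Monotone b)
    (hA : ∀ n, A n = (b (n + 2) ⊓ g (n + 2)) ⇨ (b (n + 1) ⊔ g (n + 1)))
    (hD : Antitone fun n => A n ⊔ A (n + 1)) (hκ : ∀ n, A (n + 1) ≤ A n ⊔ b (n + 2))
    {m n : ℕ} (hmn : m ≠ n) :
    b (n + 2) ⊓ g (n + 2) ≤ (b (n + 1) ⊔ g (n + 1)) ⊔ A m := by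
  rcases hmn.lt_or_gt with h | h
  · obtain ⟨j, rfl⟩ := Nat.exists_eq_add_of_lt h
    clear h hmn
    induction j generalizing m with
    | zero =>
      have h1 := beta_le_delta hb hA hD (m + 0 + 1 + 2) m
      have h2 : A (m + 1) ⊓ (b (m + 1 + 2) ⊓ g (m + 1 + 2)) ≤
          b (m + 1 + 1) ⊔ g (m + 1 + 1) := by
        rw [hA]; exact himp_inf_le
      calc b (m + 0 + 1 + 2) ⊓ g (m + 0 + 1 + 2)
          ≤ (A m ⊔ A (m + 1)) ⊓ (b (m + 0 + 1 + 2) ⊓ g (m + 0 + 1 + 2)) :=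
            le_inf (inf_le_left.trans h1) le_rfl
        _ ≤ _ := by
          rw [inf_sup_right]
          exact sup_le (inf_le_left.trans le_sup_right) (h2.trans le_sup_left)
    | succ j ih =>
      have h1 := ih (m := m + 1)
      rw [show m + 1 + j + 1 = m + (j + 1) + 1 by ring] at h1
      refine h1.trans (sup_le le_sup_left ((hκ m).trans (sup_le le_sup_right ?_)))
      exact (hb (by omega)).trans (le_sup_left.trans le_sup_left)
  · exact inf_le_left.trans ((beta_le_alpha hb hA (by omega)).trans le_sup_right)

/-- For `m < n`, `ϰₘ` replaces `αₘ₊₁` in `δₘ` by `βₘ₊₂`, which lies below `αₙ`. -/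
theorem delta_le_alpha_sup_alpha (hb : Monotone b)
    (hA : ∀ n, A n = (b (n + 2) ⊓ g (n + 2)) ⇨ (b (n + 1) ⊔ g (n + 1)))
    (hκ : ∀ n, A (n + 1) ≤ A n ⊔ b (n + 2))
    {x : α} (hx : ∀ k, x ≤ A k ⊔ A (k + 1)) {m n : ℕ} (hmn : m ≠ n) : x ≤ A m ⊔ A n := by
  wlog h : m < n generalizing m n
  · rw [sup_comm]
    exact this hmn.symm (by omega)
  · exact (hx m).trans (sup_le le_sup_left ((hκ m).trans
      (sup_le_sup_left (beta_le_alpha hb hA (by omega)) _)))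

/-- In a complete bi-Heyting algebra, `bb₂` and all shifts of `ϰ₀` and of `δ₁ → δ₀` force
`δ₀ = ⊤`. -/
theorem alpha_sup_alpha_eq_top (hc : ∀ s : Set α, ∃ a, IsGLB s a) (hb : Monotone b)
    (hA : ∀ n, A n = (b (n + 2) ⊓ g (n + 2)) ⇨ (b (n + 1) ⊔ g (n + 1)))
    (hD : Antitone fun n => A n ⊔ A (n + 1)) (hκ : ∀ n, A (n + 1) ≤ A n ⊔ b (n + 2))
    (hbb : ∀ p q r : α, ((p ⇨ (q ⊔ r)) ⇨ (q ⊔ r)) ⊓ ((q ⇨ (p ⊔ r)) ⇨ (p ⊔ r)) ⊓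
      ((r ⇨ (p ⊔ q)) ⇨ (p ⊔ q)) ≤ p ⊔ q ⊔ r) : A 0 ⊔ A 1 = ⊤ := by
  -- The only use of completeness: these are the meets `Pᵢ`, described by their universal property.
  have hex : ∀ i : ℕ, ∃ a : α, ∀ x, x ≤ a ↔
      (∀ k, x ≤ A k ⊔ A (k + 1)) ∧ ∀ m, m % 3 ≠ i → x ≤ A m := by
    intro i
    obtain ⟨a, ha⟩ := hc (Set.range (fun k => A k ⊔ A (k + 1)) ∪ A '' {m | m % 3 ≠ i})
    refine ⟨a, fun x => ?_⟩
    rw [le_isGLB_iff ha, lowerBounds_union, Set.mem_inter_iff]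
    simp [mem_lowerBounds]
  choose P hP using hex
  have key : ∀ i j k : ℕ, i < 3 → i ≠ j → i ≠ k → (∀ n, n % 3 ≠ j → n % 3 ≠ k → n % 3 = i) →
      (P i ⇨ (P j ⊔ P k)) ⇨ (P j ⊔ P k) = ⊤ := by
    intro i j k hi hij hik hn
    rw [himp_eq_top_iff]
    set y := P i ⇨ (P j ⊔ P k) with hy
    have hα : ∀ n, n % 3 = i → y ≤ A n := by
      intro n hni
      rw [hA, le_himp_iff]
      -- Moving the join to the left as a coimplication lets the bound by the infinite meet `P i` be
      -- tested factor by factor.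
      have h1 : b (n + 2) ⊓ g (n + 2) ≤ (b (n + 1) ⊔ g (n + 1)) ⊔ P i := by
        rw [← sdiff_le_iff, hP]
        refine ⟨fun k => ?_, fun m hm => ?_⟩
        · exact sdiff_le.trans (inf_le_left.trans (beta_le_delta hb hA hD _ _))
        · rw [sdiff_le_iff]
          exact beta_inf_gamma_le hb hA hD hκ (by rintro rfl; exact hm hni)
      -- As `n ≡ i`, the residue of `n` is neither `j` nor `k`, so `A n` is a factor of both `P j`
      -- and `P k`.
      have h2 : y ⊓ P i ≤ A n :=
        himp_inf_le.trans (sup_le (((hP j _).1 le_rfl).2 n (by omega))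
          (((hP k _).1 le_rfl).2 n (by omega)))
      have h3 : A n ⊓ (b (n + 2) ⊓ g (n + 2)) ≤ b (n + 1) ⊔ g (n + 1) := by
        rw [hA]; exact himp_inf_le
      calc y ⊓ (b (n + 2) ⊓ g (n + 2))
          ≤ (y ⊓ (b (n + 2) ⊓ g (n + 2))) ⊓ ((b (n + 1) ⊔ g (n + 1)) ⊔ P i) :=
            le_inf le_rfl (inf_le_right.trans h1)
        _ ≤ b (n + 1) ⊔ g (n + 1) := by
          rw [inf_sup_left]
          refine sup_le inf_le_right (le_trans (le_inf ?_ ?_) h3)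
          · exact (inf_le_inf_right _ inf_le_left).trans h2
          · exact inf_le_left.trans inf_le_right
    have hδ : ∀ n, y ≤ A n ⊔ A (n + 1) := fun n =>
      -- `3 * n + i` is an index of residue `i` that is at least `n`.
      (hα (3 * n + i) (by omega)).trans
        (le_sup_left.trans (hD (show n ≤ 3 * n + i by omega)))
    -- Applying the adjunction to each join factor in turn leaves `y ≤ A m ⊔ A n` with `m ≢ j` and
    -- `n ≢ k`; the two indices can coincide only in residue `i`, where `hα` applies.
    rw [← sdiff_le_iff, hP]
    refine ⟨fun n => sdiff_le.trans (hδ n), fun m hm => ?_⟩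
    rw [sdiff_le_iff, sup_comm, ← sdiff_le_iff, hP]
    refine ⟨fun n => sdiff_le.trans (hδ n), fun n hn' => ?_⟩
    rw [sdiff_le_iff]
    by_cases hmn : m = n
    · subst hmn
      exact (hα m (hn m hn' hm)).trans le_sup_left
    · exact delta_le_alpha_sup_alpha hb hA hκ hδ hmn
  have h := hbb (P 0) (P 1) (P 2)
  rw [key 0 1 2 (by omega) (by omega) (by omega) (by omega),
    key 1 0 2 (by omega) (by omega) (by omega) (by omega),
    key 2 0 1 (by omega) (by omega) (by omega) (by omega)] at h
  simp only [inf_idem] at h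
  refine top_le_iff.1 (h.trans ?_)
  exact sup_le (sup_le (((hP 0 _).1 le_rfl).1 0) (((hP 1 _).1 le_rfl).1 0))
    (((hP 2 _).1 le_rfl).1 0)

/-! ### The substitution that shifts the indices -/

/-- The valuation `p ↦ β₀ ∨ q`, `q ↦ γ₀ ∨ p`, which shifts the formulas `βₙ`, `γₙ` by one. -/
def shiftVal (v : ℕ → α) : ℕ → α
  | 0 => (v 1 ⇨ v 0) ⊔ v 1
  | _ + 1 => (v 0 ⇨ v 1) ⊔ v 0

theorem eval_beta_add_two (v : ℕ → α) (n : ℕ) : (Form.beta (n + 2)).eval v =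
    (Form.gamma (n + 1)).eval v ⇨ ((Form.beta (n + 1)).eval v ⊔ (Form.gamma n).eval v) := by
  simp [Form.beta, Form.gamma, Form.betaGamma, Form.eval]

theorem eval_gamma_add_two (v : ℕ → α) (n : ℕ) : (Form.gamma (n + 2)).eval v =
    (Form.beta (n + 1)).eval v ⇨ ((Form.gamma (n + 1)).eval v ⊔ (Form.beta n).eval v) := by
  simp [Form.beta, Form.gamma, Form.betaGamma, Form.eval]

/-- The shifted `β₀` is `(γ₀ ∨ p) → (β₀ ∨ q)`, which splits into `β₁` and `p → (β₀ ∨ q)`; the latter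
is `⊤` because `p ≤ β₀`. Dually for `γ₀`. -/
theorem eval_shiftVal_zero (v : ℕ → α) :
    (Form.beta 0).eval (shiftVal v) = (Form.beta 1).eval v ∧
      (Form.gamma 0).eval (shiftVal v) = (Form.gamma 1).eval v := by
  simp only [Form.beta, Form.gamma, Form.betaGamma, Form.eval, Form.p, Form.q, shiftVal,
    sup_himp_distrib]
  constructor
  · refine inf_eq_left.2 (le_top.trans_eq (himp_eq_top_iff.2 ?_).symm)
    exact le_sup_of_le_left le_himp
  · refine inf_eq_left.2 (le_top.trans_eq (himp_eq_top_iff.2 ?_).symm)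
    exact le_sup_of_le_left le_himp

/-- The shifted `β₁` has `γ₀ ∨ p` where `β₂` has `γ₀`, and the extra `p` is absorbed by `β₁`. Dually
for `γ₁`. -/
theorem eval_shiftVal_one (v : ℕ → α) :
    (Form.beta 1).eval (shiftVal v) = (Form.beta 2).eval v ∧
      (Form.gamma 1).eval (shiftVal v) = (Form.gamma 2).eval v := by
  obtain ⟨h1, h2⟩ := eval_shiftVal_zero v
  have e1 : (Form.beta 1).eval (shiftVal v) = (Form.gamma 0).eval (shiftVal v) ⇨
      ((Form.beta 0).eval (shiftVal v) ⊔ shiftVal v 1) := rfl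
  have e2 : (Form.gamma 1).eval (shiftVal v) = (Form.beta 0).eval (shiftVal v) ⇨
      ((Form.gamma 0).eval (shiftVal v) ⊔ shiftVal v 0) := rfl
  have e3 : shiftVal v 1 = (Form.gamma 0).eval v ⊔ v 0 := rfl
  have e4 : shiftVal v 0 = (Form.beta 0).eval v ⊔ v 1 := rfl
  have l1 : v 0 ≤ (Form.beta 1).eval v := by
    simp only [Form.beta, Form.betaGamma, Form.eval, Form.p, Form.q]
    exact (le_himp (b := v 1)).trans (le_sup_left.trans le_himp)
  have l2 : v 1 ≤ (Form.gamma 1).eval v := by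
    simp only [Form.gamma, Form.betaGamma, Form.eval, Form.p, Form.q]
    exact (le_himp (b := v 0)).trans (le_sup_left.trans le_himp)
  rw [e1, e2, h1, h2, e3, e4, eval_beta_add_two v 0, eval_gamma_add_two v 0, ← sup_assoc,
    ← sup_assoc, sup_eq_left.2 (l1.trans le_sup_left), sup_eq_left.2 (l2.trans le_sup_left)]
  exact ⟨rfl, rfl⟩

theorem eval_shiftVal (v : ℕ → α) (n : ℕ) :
    (Form.beta n).eval (shiftVal v) = (Form.beta (n + 1)).eval v ∧
      (Form.gamma n).eval (shiftVal v) = (Form.gamma (n + 1)).eval v := by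
  induction n using Nat.twoStepInduction with
  | zero => exact eval_shiftVal_zero v
  | one => exact eval_shiftVal_one v
  | more n ih₁ ih₂ =>
    rw [eval_beta_add_two, eval_gamma_add_two, eval_beta_add_two, eval_gamma_add_two, ih₁.1, ih₁.2,
      ih₂.1, ih₂.2]
    exact ⟨rfl, rfl⟩

theorem eval_alpha (v : ℕ → α) (n : ℕ) : (Form.alpha n).eval v =
    ((Form.beta (n + 2)).eval v ⊓ (Form.gamma (n + 2)).eval v) ⇨
      ((Form.beta (n + 1)).eval v ⊔ (Form.gamma (n + 1)).eval v) := rfl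

theorem eval_delta (v : ℕ → α) (n : ℕ) : (Form.delta n).eval v =
    (Form.alpha n).eval v ⊔ (Form.alpha (n + 1)).eval v := rfl

theorem eval_iterate_shiftVal (v : ℕ → α) (k n : ℕ) :
    (Form.beta n).eval (shiftVal^[k] v) = (Form.beta (n + k)).eval v ∧
      (Form.alpha n).eval (shiftVal^[k] v) = (Form.alpha (n + k)).eval v := by
  suffices h : ∀ n, (Form.beta n).eval (shiftVal^[k] v) = (Form.beta (n + k)).eval v ∧
      (Form.gamma n).eval (shiftVal^[k] v) = (Form.gamma (n + k)).eval v by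
    refine ⟨(h n).1, ?_⟩
    rw [eval_alpha, eval_alpha, (h _).1, (h _).2, (h _).1, (h _).2]
    simp only [Nat.add_right_comm _ _ k]
  clear n
  induction k generalizing v with
  | zero => exact fun n => ⟨rfl, rfl⟩
  | succ k ih =>
    intro n
    rw [Function.iterate_succ_apply, (ih _ n).1, (ih _ n).2, (eval_shiftVal v _).1,
      (eval_shiftVal v _).2]
    exact ⟨rfl, rfl⟩

theorem monotone_eval_beta (v : ℕ → α) : Monotone fun n => (Form.beta n).eval v := by
  refine monotone_nat_of_le_succ fun n => ?_
  cases n with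
  | zero => exact le_himp.trans' le_sup_left
  | succ n => rw [eval_beta_add_two]; exact le_himp.trans' le_sup_left

end Complete

/-- Complete models of the Shehtman logic validate `δ₀`. -/
theorem validates_delta_zero {B : BHAlg.{u}} (hB : B ∈ shehtmanVariety.{u}) (hc : B.IsComplete) :
    B.Validates (Form.delta 0) := by
  intro v
  refine alpha_sup_alpha_eq_top (b := fun n => (Form.beta n).eval v)
    (g := fun n => (Form.gamma n).eval v) (A := fun n => (Form.alpha n).eval v)
    (fun s => ?_) (monotone_eval_beta v) (eval_alpha v) ?_ (fun n => ?_) (fun x y z => ?_)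
  · obtain ⟨a, ha⟩ := hc (lowerBounds s)
    exact ⟨a, isLUB_lowerBounds.1 ha⟩
  · refine antitone_nat_of_succ_le fun n => ?_
    have h := hB _ (Derivable.ax (Or.inl rfl)) (shiftVal^[n] v)
    -- Only the weakening `δ₁ → δ₀` of the axiom is needed here, since `δ₁ ≤ α₀ → δ₁`.
    have h' := le_himp.trans (himp_eq_top_iff.1 h)
    simp only [eval_delta, (eval_iterate_shiftVal v n _).2] at h'
    simpa [add_comm, add_left_comm, add_assoc] using h'
  · have h := hB _ (Derivable.ax (Or.inr (Or.inl rfl))) (shiftVal^[n] v)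
    have h' := himp_eq_top_iff.1 h
    simp only [Form.eval, (eval_iterate_shiftVal v n _).2, (eval_iterate_shiftVal v n _).1] at h'
    simpa [add_comm, add_left_comm, add_assoc] using h'
  · have h := hB _ (Derivable.ax (Or.inr (Or.inr rfl)))
      (fun n => match n with | 0 => x | 1 => y | _ => z)
    exact himp_eq_top_iff.1 h

/-! ### The algebra of clopen upsets of the compactified Fine frame -/

open OnePoint

namespace FineSpace

/-- The points `aₙ`. -/
def pa (n : ℕ) : FineSpace.{u} := OnePoint.some (.a n)

/-- The points `bₙ` (for `true`) and `cₙ` (for `false`). -/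
def bc : Bool → ℕ → FineSpace.{u}
  | true, n => OnePoint.some (.b n)
  | false, n => OnePoint.some (.c n)

/-- The points `dₙ`. -/
def pd (n : ℕ) : FineSpace.{u} := OnePoint.some (.d n)

theorem eq_cases (x : FineSpace.{u}) :
    x = ∞ ∨ (∃ n, x = pa n) ∨ (∃ s n, x = bc s n) ∨ ∃ n, x = pd n := by
  rcases x with _ | n | n | n | n
  · exact Or.inl rfl
  · exact Or.inr (Or.inl ⟨n, rfl⟩)
  · exact Or.inr (Or.inr (Or.inl ⟨true, n, rfl⟩))
  · exact Or.inr (Or.inr (Or.inl ⟨false, n, rfl⟩))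
  · exact Or.inr (Or.inr (Or.inr ⟨n, rfl⟩))

theorem infty_le_bc (s : Bool) (n : ℕ) : (∞ : FineSpace.{u}) ≤ bc s n := by
  cases s <;> trivial

theorem not_infty_le_pa (n : ℕ) : ¬ (∞ : FineSpace.{u}) ≤ pa n := id

theorem not_infty_le_pd (n : ℕ) : ¬ (∞ : FineSpace.{u}) ≤ pd n := id

theorem not_pa_le_infty (n : ℕ) : ¬ (pa n : FineSpace.{u}) ≤ ∞ := id

theorem not_bc_le_infty (s : Bool) (n : ℕ) : ¬ (bc s n : FineSpace.{u}) ≤ ∞ := by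
  cases s <;> exact id

theorem pd_le_infty (n : ℕ) : (pd n : FineSpace.{u}) ≤ ∞ := trivial

theorem pa_le_pa {m n : ℕ} : (pa m : FineSpace.{u}) ≤ pa n ↔ m = n := Iff.rfl

theorem pa_le_bc {m n : ℕ} {s : Bool} : (pa m : FineSpace.{u}) ≤ bc s n ↔ n ≤ m + 1 := by
  cases s <;> exact Iff.rfl

theorem not_pa_le_pd (m n : ℕ) : ¬ (pa m : FineSpace.{u}) ≤ pd n := id

theorem not_bc_le_pa (s : Bool) (m n : ℕ) : ¬ (bc s m : FineSpace.{u}) ≤ pa n := by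
  cases s <;> exact id

theorem not_bc_le_pd (s : Bool) (m n : ℕ) : ¬ (bc s m : FineSpace.{u}) ≤ pd n := by
  cases s <;> exact id

theorem bc_le_bc {s t : Bool} {m n : ℕ} :
    (bc s m : FineSpace.{u}) ≤ bc t n ↔ (s = t ∧ n ≤ m) ∨ n + 2 ≤ m := by
  cases s <;> cases t
  · exact (show (bc false m : FineSpace.{u}) ≤ bc false n ↔ n ≤ m from Iff.rfl).trans (by grind)
  · exact (show (bc false m : FineSpace.{u}) ≤ bc true n ↔ n + 2 ≤ m from Iff.rfl).trans (by grind)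
  · exact (show (bc true m : FineSpace.{u}) ≤ bc false n ↔ n + 2 ≤ m from Iff.rfl).trans (by grind)
  · exact (show (bc true m : FineSpace.{u}) ≤ bc true n ↔ n ≤ m from Iff.rfl).trans (by grind)

theorem pd_le_pd {m n : ℕ} : (pd m : FineSpace.{u}) ≤ pd n ↔ m ≤ n := Iff.rfl

theorem pd_le_pa {m n : ℕ} : (pd m : FineSpace.{u}) ≤ pa n ↔ m ≤ n := Iff.rfl

theorem pd_le_bc (m n : ℕ) (s : Bool) : (pd m : FineSpace.{u}) ≤ bc s n := by
  cases s <;> trivial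

theorem bc_inj {s t : Bool} {m n : ℕ} : (bc s m : FineSpace.{u}) = bc t n ↔ s = t ∧ m = n := by
  rw [le_antisymm_iff, bc_le_bc, bc_le_bc]
  grind

theorem mem_himp {U V : ClopenUpperSet FineSpace.{u}} {x : FineSpace.{u}} :
    x ∈ U ⇨ V ↔ ∀ y, x ≤ y → y ∈ U → y ∈ V := by
  change ¬ (∃ y, (y ∈ U ∧ y ∉ V) ∧ x ≤ y) ↔ _
  grind

theorem mem_sup {U V : ClopenUpperSet FineSpace.{u}} {x : FineSpace.{u}} :
    x ∈ U ⊔ V ↔ x ∈ U ∨ x ∈ V := Iff.rfl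

theorem mem_inf {U V : ClopenUpperSet FineSpace.{u}} {x : FineSpace.{u}} :
    x ∈ U ⊓ V ↔ x ∈ U ∧ x ∈ V := Iff.rfl

theorem le_iff {U V : ClopenUpperSet FineSpace.{u}} : U ≤ V ↔ ∀ x, x ∈ U → x ∈ V := Iff.rfl

/-! ### The Gabbay-de Jongh formula -/

/-- Every point other than `∞` has at most two covers, which lie below all larger points. -/
theorem exists_covers {y : FineSpace.{u}} (hy : y ≠ ∞) :
    (∀ z, ¬ y < z) ∨ ∃ s t, y < s ∧ y < t ∧ ∀ z, y < z → s ≤ z ∨ t ≤ z := by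
  simp only [lt_iff_le_not_ge]
  rcases eq_cases y with rfl | ⟨n, rfl⟩ | ⟨s, n, rfl⟩ | ⟨n, rfl⟩
  · exact (hy rfl).elim
  · refine Or.inr ⟨bc true (n + 1), bc false (n + 1), ?_, ?_, fun z => ?_⟩
    · simp [pa_le_bc, not_bc_le_pa]
    · simp [pa_le_bc, not_bc_le_pa]
    · rcases eq_cases z with rfl | ⟨m, rfl⟩ | ⟨s, m, rfl⟩ | ⟨m, rfl⟩
      · simp [not_pa_le_infty]
      · simp only [pa_le_pa]; grind
      · cases s <;> simp only [pa_le_bc, bc_le_bc] <;> grind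
      · simp [not_pa_le_pd]
  · rcases n with _ | _ | n
    · refine Or.inl fun z => ?_
      rcases eq_cases z with rfl | ⟨m, rfl⟩ | ⟨t, m, rfl⟩ | ⟨m, rfl⟩
      · simp [not_bc_le_infty]
      · simp [not_bc_le_pa]
      · simp only [bc_le_bc]; grind
      · simp [not_bc_le_pd]
    -- `b₁` and `c₁` have a single cover, listed twice.
    · refine Or.inr ⟨bc s 0, bc s 0, by simp [bc_le_bc], by simp [bc_le_bc], fun z => ?_⟩
      rcases eq_cases z with rfl | ⟨m, rfl⟩ | ⟨t, m, rfl⟩ | ⟨m, rfl⟩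
      · simp [not_bc_le_infty]
      · simp [not_bc_le_pa]
      · simp only [bc_le_bc]; grind
      · simp [not_bc_le_pd]
    · refine Or.inr ⟨bc s (n + 1), bc (!s) n, by simp [bc_le_bc], ?_, fun z => ?_⟩
      · simp only [bc_le_bc]; grind
      rcases eq_cases z with rfl | ⟨m, rfl⟩ | ⟨t, m, rfl⟩ | ⟨m, rfl⟩
      · simp [not_bc_le_infty]
      · simp [not_bc_le_pa]
      · cases s <;> cases t <;> simp only [bc_le_bc] <;> grind
      · simp [not_bc_le_pd]
  · refine Or.inr ⟨pd (n + 1), pa n, by simp [pd_le_pd], by simp [pd_le_pa, not_pa_le_pd],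
      fun z => ?_⟩
    rcases eq_cases z with rfl | ⟨m, rfl⟩ | ⟨t, m, rfl⟩ | ⟨m, rfl⟩
    · simp [pd_le_infty]
    · simp only [pd_le_pa, pa_le_pa]; grind
    · simp [pd_le_bc]
    · simp only [pd_le_pd]; grind

/-! ### Maximal points outside a clopen upset -/

section Maximal

variable {U : ClopenUpperSet FineSpace.{u}}

theorem exists_bc_notMem (h : (∞ : FineSpace.{u}) ∉ U) : ∃ n, bc true n ∉ U := by
  obtain ⟨N, hN⟩ := ((isClopen_iff _).1 U.isClopen).2 h
  refine ⟨N + 1, fun hm => ?_⟩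
  have := hN _ hm
  simp [FineFrame.index] at this

theorem exists_pd_mem (h : (∞ : FineSpace.{u}) ∈ U) : ∃ n, pd n ∈ U := by
  obtain ⟨N, hN⟩ := ((isClopen_iff _).1 U.isClopen).1 h
  exact ⟨N + 1, hN (.d (N + 1)) (Nat.lt_succ_self N)⟩

/-- Every strict step upwards among the `b`'s and `c`'s lowers the index, so the climb terminates.
-/
theorem exists_maximal_notMem_of_bc (s : Bool) (n : ℕ) (h : bc s n ∉ U) :
    ∃ y, bc s n ≤ y ∧ y ∉ U ∧ y ≠ ∞ ∧ ∀ z, y < z → z ∈ U := by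
  induction n using Nat.strong_induction_on generalizing s with
  | _ n ih =>
    by_cases hz : ∀ z, bc s n < z → z ∈ U
    · exact ⟨bc s n, le_rfl, h, fun e => not_bc_le_infty s n e.le, hz⟩
    · push Not at hz
      obtain ⟨z, hlt, hz⟩ := hz
      have hlt' := lt_iff_le_not_ge.1 hlt
      rcases eq_cases z with rfl | ⟨m, rfl⟩ | ⟨t, m, rfl⟩ | ⟨m, rfl⟩
      · exact (not_bc_le_infty _ _ hlt.le).elim
      · exact (not_bc_le_pa _ _ _ hlt.le).elim
      · simp only [bc_le_bc] at hlt'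
        obtain ⟨y, hy, h'⟩ := ih m (by grind) t hz
        exact ⟨y, hlt.le.trans hy, h'⟩
      · exact (not_bc_le_pd _ _ _ hlt.le).elim

theorem exists_maximal_notMem_of_ne_pd {x : FineSpace.{u}} (h : x ∉ U) (hx : ∀ n, x ≠ pd n) :
    ∃ y, x ≤ y ∧ y ∉ U ∧ y ≠ ∞ ∧ ∀ z, y < z → z ∈ U := by
  rcases eq_cases x with rfl | ⟨n, rfl⟩ | ⟨s, n, rfl⟩ | ⟨n, rfl⟩
  · obtain ⟨n, hn⟩ := exists_bc_notMem h
    obtain ⟨y, hy, h'⟩ := exists_maximal_notMem_of_bc true n hn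
    exact ⟨y, (infty_le_bc _ _).trans hy, h'⟩
  · by_cases hz : ∀ z, pa n < z → z ∈ U
    · exact ⟨pa n, le_rfl, h, fun e => not_pa_le_infty n e.le, hz⟩
    · push Not at hz
      obtain ⟨z, hlt, hz⟩ := hz
      rcases eq_cases z with rfl | ⟨m, rfl⟩ | ⟨t, m, rfl⟩ | ⟨m, rfl⟩
      · exact (not_pa_le_infty _ hlt.le).elim
      · have := pa_le_pa.1 hlt.le
        subst this
        exact (lt_irrefl _ hlt).elim
      · obtain ⟨y, hy, h'⟩ := exists_maximal_notMem_of_bc t m hz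
        exact ⟨y, hlt.le.trans hy, h'⟩
      · exact (not_pa_le_pd _ _ hlt.le).elim
  · exact exists_maximal_notMem_of_bc s n h
  · exact (hx n rfl).elim

/-- Above every point outside a clopen upset there is a maximal one, and it is not `∞`. -/
theorem exists_maximal_notMem {x : FineSpace.{u}} (h : x ∉ U) :
    ∃ y, x ≤ y ∧ y ∉ U ∧ y ≠ ∞ ∧ ∀ z, y < z → z ∈ U := by
  by_cases hw : ∃ w, x ≤ w ∧ w ∉ U ∧ ∀ n, w ≠ pd n
  · obtain ⟨w, hxw, hw, hd⟩ := hw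
    obtain ⟨y, hy, h'⟩ := exists_maximal_notMem_of_ne_pd hw hd
    exact ⟨y, hxw.trans hy, h'⟩
  · push Not at hw
    obtain ⟨n, rfl⟩ := hw x le_rfl h
    -- All points above `x` outside `U` are now `d`'s, so `∞ ∈ U`; clopenness then puts almost all
    -- `d`'s into `U`, and the last one outside is maximal.
    have hi : (∞ : FineSpace.{u}) ∈ U := by
      by_contra hi
      obtain ⟨m, hm⟩ := hw ∞ (pd_le_infty n) hi
      exact not_infty_le_pd m hm.le
    obtain ⟨N, hN⟩ := exists_pd_mem hi
    have hlt : ∀ m, pd m ∉ U → m < N := fun m hm => by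
      by_contra hle
      exact hm (U.upper (pd_le_pd.2 (not_lt.1 hle)) hN)
    classical
    have hm := Nat.findGreatest_spec (P := fun m => pd m ∉ U) (hlt n h).le h
    have hnm := Nat.le_findGreatest (P := fun m => pd m ∉ U) (hlt n h).le h
    refine ⟨_, pd_le_pd.2 hnm, hm, fun e => not_infty_le_pd _ e.ge, fun z hz => ?_⟩
    by_contra hzU
    obtain ⟨k, rfl⟩ := hw z ((pd_le_pd.2 hnm).trans hz.le) hzU
    have hk := Nat.le_findGreatest (P := fun m => pd m ∉ U) (hlt k hzU).le hzU
    exact hz.not_ge (pd_le_pd.2 hk)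

end Maximal

/-- At a maximal point `y` outside `P ⊔ Q ⊔ R`, the premises give three points above `y`, each in
exactly one of `P`, `Q`, `R`. Each lies above one of two covers, and each cover is already in one of
the three upsets, so two covers cannot serve three points. -/
theorem bb2_le (P Q R : ClopenUpperSet FineSpace.{u}) :
    ((P ⇨ (Q ⊔ R)) ⇨ (Q ⊔ R)) ⊓ ((Q ⇨ (P ⊔ R)) ⇨ (P ⊔ R)) ⊓ ((R ⇨ (P ⊔ Q)) ⇨ (P ⊔ Q)) ≤
      P ⊔ Q ⊔ R := by
  rw [le_iff]
  intro x hx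
  by_contra hxn
  obtain ⟨y, hxy, hyn, hyi, hmax⟩ := exists_maximal_notMem hxn
  simp only [mem_inf, mem_sup, not_or] at hx hyn hmax
  have aux : ∀ S T W : ClopenUpperSet FineSpace.{u}, x ∈ (S ⇨ (T ⊔ W)) ⇨ (T ⊔ W) →
      y ∉ S → y ∉ T → y ∉ W → ∃ z, y < z ∧ z ∈ S ∧ z ∉ T ∧ z ∉ W := by
    intro S T W h hS hT hW
    have h1 : y ∉ S ⇨ (T ⊔ W) := fun h2 => by
      have := mem_himp.1 h y hxy h2
      rw [mem_sup] at this
      tauto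
    rw [mem_himp] at h1
    push Not at h1
    obtain ⟨z, hyz, hzS, hz⟩ := h1
    rw [mem_sup, not_or] at hz
    exact ⟨z, lt_of_le_of_ne hyz (by rintro rfl; exact hS hzS), hzS, hz.1, hz.2⟩
  obtain ⟨z₁, h₁⟩ := aux P Q R hx.1.1 hyn.1.1 hyn.1.2 hyn.2
  obtain ⟨z₂, h₂⟩ := aux Q P R hx.1.2 hyn.1.2 hyn.1.1 hyn.2
  obtain ⟨z₃, h₃⟩ := aux R P Q hx.2 hyn.2 hyn.1.1 hyn.1.2
  rcases exists_covers hyi with h | ⟨s, t, hs, ht, hst⟩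
  · exact h _ h₁.1
  · have uP : ∀ a b, a ≤ b → a ∈ P → b ∈ P := fun a b h ha => P.upper h ha
    have uQ : ∀ a b, a ≤ b → a ∈ Q → b ∈ Q := fun a b h ha => Q.upper h ha
    have uR : ∀ a b, a ≤ b → a ∈ R → b ∈ R := fun a b h ha => R.upper h ha
    have hs' := hmax s hs
    have ht' := hmax t ht
    have k₁ := hst _ h₁.1
    have k₂ := hst _ h₂.1
    have k₃ := hst _ h₃.1
    grind

/-! ### The Shehtman axioms in the algebra of clopen upsets -/

/-- The one point where `βₙ₊₂` (or `γₙ₊₂`) fails directly, once the failure sets at the two previous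
levels are known. -/
theorem not_le_bc_iff {s : Bool} {m : ℕ} {z : FineSpace.{u}} :
    (¬ z ≤ bc (!s) (m + 1) ∧ z ≤ bc s (m + 1) ∧ z ≤ bc (!s) m) ↔ z = bc s (m + 2) := by
  rcases eq_cases z with rfl | ⟨n, rfl⟩ | ⟨t, n, rfl⟩ | ⟨n, rfl⟩
  · simp only [infty_le_bc, not_true, false_and, false_iff]
    exact fun e => not_bc_le_infty _ _ e.ge
  · simp only [pa_le_bc]
    refine ⟨by omega, fun e => (not_bc_le_pa _ _ _ e.ge).elim⟩
  · simp only [bc_le_bc, bc_inj]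
    cases s <;> cases t <;> grind
  · simp only [pd_le_bc, not_true, false_and, false_iff]
    exact fun e => not_bc_le_pd _ _ _ e.ge

/-- The same for `α`: the point that satisfies its premise and not its conclusion. -/
theorem eq_pa_iff {s : Bool} {m : ℕ} {z : FineSpace.{u}} :
    (¬ z ≤ bc s (m + 2) ∧ ¬ z ≤ bc (!s) (m + 2) ∧ z ≤ bc s (m + 1) ∧ z ≤ bc (!s) (m + 1)) ↔
      z = pa m := by
  rcases eq_cases z with rfl | ⟨n, rfl⟩ | ⟨t, n, rfl⟩ | ⟨n, rfl⟩
  · simp only [infty_le_bc, not_true, false_and, false_iff]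
    exact fun e => not_infty_le_pa _ e.le
  · rw [le_antisymm_iff]
    simp only [pa_le_bc, pa_le_pa]
    omega
  · simp only [bc_le_bc]
    refine ⟨?_, fun e => (not_bc_le_pa _ _ _ e.le).elim⟩
    cases s <;> cases t <;> grind
  · simp only [pd_le_bc, not_true, false_and, false_iff]
    exact fun e => not_pa_le_pd _ _ e.ge

/-- The position of two clopen upsets `P` and `Q` in which the formulas `βₖ`, `γₖ` in `P`, `Q`
fail exactly below `bₙ₊ₖ` and `cₙ₊ₖ` (or the other way round) for all `k ≥ 1`. -/
structure IsFinePair (P Q : ClopenUpperSet FineSpace.{u}) (s : Bool) (n : ℕ) : Prop where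
  left_mem : bc s n ∈ Q
  left_notMem : bc s n ∉ P
  right_mem : bc (!s) n ∈ P
  right_notMem : bc (!s) n ∉ Q
  left_succ_notMem : bc s (n + 1) ∉ Q
  right_succ_notMem : bc (!s) (n + 1) ∉ P
  left_succ_himp : bc s (n + 1) ∈ P ⇨ Q
  right_succ_himp : bc (!s) (n + 1) ∈ Q ⇨ P

/-! ### The position of `p` and `q` when `α₀` fails -/

section Pair

variable {P Q : ClopenUpperSet FineSpace.{u}} {s : Bool} {n : ℕ}

theorem IsFinePair.symm (h : IsFinePair P Q s n) : IsFinePair Q P (!s) n where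
  left_mem := h.right_mem
  left_notMem := h.right_notMem
  right_mem := by simpa using h.left_mem
  right_notMem := by simpa using h.left_notMem
  left_succ_notMem := h.right_succ_notMem
  right_succ_notMem := by simpa using h.left_succ_notMem
  left_succ_himp := h.right_succ_himp
  right_succ_himp := by simpa using h.left_succ_himp

/-- Below `bc s (n + 1)`, the only point not below `bc (!s) n` is `bc s (n + 1)` itself. -/
theorem IsFinePair.mem_himp_iff (h : IsFinePair P Q s n) {y : FineSpace.{u}}
    (hy : y ≤ bc s (n + 1)) : y ∈ P ⇨ Q ↔ ¬ y ≤ bc (!s) n := by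
  refine ⟨fun hyP hle => h.right_notMem (mem_himp.1 hyP _ hle h.right_mem), fun hle => ?_⟩
  have hy' : y = bc s (n + 1) := by
    rcases eq_cases y with rfl | ⟨m, rfl⟩ | ⟨t, m, rfl⟩ | ⟨m, rfl⟩
    · exact (hle (infty_le_bc _ _)).elim
    · simp only [pa_le_bc] at *
      omega
    · simp only [bc_le_bc, bc_inj] at *
      cases s <;> cases t <;> grind
    · exact (hle (pd_le_bc _ _ _)).elim
  exact hy' ▸ h.left_succ_himp

theorem IsFinePair.mem_beta_one_iff (h : IsFinePair P Q s n) {y : FineSpace.{u}} :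
    y ∈ (P ⇨ Q) ⇨ ((Q ⇨ P) ⊔ Q) ↔ ¬ y ≤ bc s (n + 1) := by
  rw [mem_himp]
  constructor
  · intro hy hle
    rcases hy _ hle h.left_succ_himp with h' | h'
    · exact h.left_notMem (mem_himp.1 h' _ (bc_le_bc.2 (by simp)) h.left_mem)
    · exact h.left_succ_notMem h'
  · intro hle z hyz hz
    by_contra hn
    rw [mem_sup, not_or] at hn
    obtain ⟨hzβ, hzQ⟩ := hn
    have hzc : ¬ z ≤ bc (!s) n := fun hzc =>
      h.right_notMem (mem_himp.1 hz _ hzc h.right_mem)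
    have hbz : ¬ bc s n ≤ z := fun hbz => hzQ (Q.upper hbz h.left_mem)
    have hcz : ¬ bc (!s) (n + 1) ≤ z := fun hcz =>
      hzβ ((Q ⇨ P).upper hcz h.right_succ_himp)
    have hzw : ¬ z ≤ bc s (n + 1) := fun hzw => hle (hyz.trans hzw)
    rw [mem_himp] at hzβ
    push Not at hzβ
    obtain ⟨x, hzx, hxQ, hxP⟩ := hzβ
    have hcx : ¬ bc (!s) (n + 1) ≤ x := fun hcx => hxP (mem_himp.1 h.right_succ_himp _ hcx hxQ)
    have hne : ¬ x ≤ z := fun hxz => hzQ (Q.upper hxz hxQ)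
    rcases eq_cases z with rfl | ⟨m, rfl⟩ | ⟨t, m, rfl⟩ | ⟨m, rfl⟩
    · exact hzc (infty_le_bc _ _)
    -- Only for `z = pa m` is `x` needed: `hzc` gives `m + 1 < n`, so every `b` or `c` above `z` is
    -- also above `bc (!s) (n + 1)`, against `hcx`.
    · rcases eq_cases x with rfl | ⟨k, rfl⟩ | ⟨t, k, rfl⟩ | ⟨k, rfl⟩
      · exact not_pa_le_infty _ hzx
      · simp only [pa_le_pa] at *
        omega
      · simp only [pa_le_bc, bc_le_bc] at *
        cases s <;> cases t <;> grind
      · exact not_pa_le_pd _ _ hzx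
    · simp only [bc_le_bc] at *
      cases s <;> cases t <;> grind
    · exact hzc (pd_le_bc _ _ _)

/-- Two clopen upsets for which `α₀` can fail are in the position of `IsFinePair`. -/
theorem exists_isFinePair {w v : FineSpace.{u}} (hwγ : w ∈ P ⇨ Q) (hwβ : w ∉ Q ⇨ P) (hwQ : w ∉ Q)
    (hvβ : v ∈ Q ⇨ P) (hvγ : v ∉ P ⇨ Q) (hvP : v ∉ P) : ∃ s n, IsFinePair P Q s n := by
  obtain ⟨x, hwx, hxQ, hxP⟩ : ∃ x, w ≤ x ∧ x ∈ Q ∧ x ∉ P := by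
    rw [mem_himp] at hwβ
    push Not at hwβ
    exact hwβ
  obtain ⟨y, hvy, hyP, hyQ⟩ : ∃ y, v ≤ y ∧ y ∈ P ∧ y ∉ Q := by
    rw [mem_himp] at hvγ
    push Not at hvγ
    exact hvγ
  have hwy : ¬ w ≤ y := fun hle => hyQ (mem_himp.1 hwγ _ hle hyP)
  have hvx : ¬ v ≤ x := fun hle => hxP (mem_himp.1 hvβ _ hle hxQ)
  have hxw : ¬ x ≤ w := fun hle => hwQ (Q.upper hle hxQ)
  have hyv : ¬ y ≤ v := fun hle => hvP (P.upper hle hyP)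
  -- The chains `w < x` and `v < y` have no relations between them; the only such pairs of chains
  -- are `bₙ₊₁ < bₙ` and `cₙ₊₁ < cₙ`.
  have key : ∃ s n, x = bc s n ∧ y = bc (!s) n ∧ w = bc s (n + 1) ∧ v = bc (!s) (n + 1) := by
    rcases eq_cases x with rfl | ⟨i, rfl⟩ | ⟨s, i, rfl⟩ | ⟨i, rfl⟩ <;>
    rcases eq_cases y with rfl | ⟨j, rfl⟩ | ⟨t, j, rfl⟩ | ⟨j, rfl⟩ <;>
    rcases eq_cases w with rfl | ⟨k, rfl⟩ | ⟨e, k, rfl⟩ | ⟨k, rfl⟩ <;>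
    simp only [infty_le_bc, not_infty_le_pa, not_infty_le_pd, not_pa_le_infty, not_bc_le_infty,
      pd_le_infty, pa_le_pa, pa_le_bc, not_pa_le_pd, not_bc_le_pa, not_bc_le_pd, bc_le_bc,
      pd_le_pd, pd_le_pa, pd_le_bc, le_refl, not_true, not_false_iff] at hwx hwy hxw <;>
    rcases eq_cases v with rfl | ⟨l, rfl⟩ | ⟨f, l, rfl⟩ | ⟨l, rfl⟩ <;>
    simp only [infty_le_bc, not_infty_le_pa, not_infty_le_pd, not_pa_le_infty, not_bc_le_infty,
      pd_le_infty, pa_le_pa, pa_le_bc, not_pa_le_pd, not_bc_le_pa, not_bc_le_pd, bc_le_bc,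
      pd_le_pd, pd_le_pa, pd_le_bc, le_refl, not_true, not_false_iff] at hvx hvy hyv
    all_goals first
      | omega
      | (simp only [bc_inj]; refine ⟨s, i, ?_⟩; cases s <;> cases t <;> cases e <;> cases f <;> grind)
      | grind
  obtain ⟨s, n, rfl, rfl, rfl, rfl⟩ := key
  exact ⟨s, n, hxQ, hxP, hyP, hyQ, hwQ, hvP, hwγ, hvβ⟩

end Pair

/-! ### Values of the formulas at such a pair -/

section Eval

variable {v : ℕ → ClopenUpperSet FineSpace.{u}} {s : Bool} {n : ℕ}

/-- The two relative clauses serve to start the induction: `β₀` and `γ₀` are controlled only below a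
point of the opposite side, which is all the recursion uses. For higher indices they follow from the
absolute clauses. -/
theorem IsFinePair.mem_eval_beta_gamma (h : IsFinePair (v 0) (v 1) s n) (k : ℕ) :
    (∀ y, y ∈ (Form.beta (k + 1)).eval v ↔ ¬ y ≤ bc s (n + k + 1)) ∧
    (∀ y, y ∈ (Form.gamma (k + 1)).eval v ↔ ¬ y ≤ bc (!s) (n + k + 1)) ∧
    (∀ y, y ≤ bc (!s) (n + k + 1) → (y ∈ (Form.beta k).eval v ↔ ¬ y ≤ bc s (n + k))) ∧
    (∀ y, y ≤ bc s (n + k + 1) → (y ∈ (Form.gamma k).eval v ↔ ¬ y ≤ bc (!s) (n + k))) := by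
  induction k with
  | zero =>
    refine ⟨fun y => h.mem_beta_one_iff, fun y => h.symm.mem_beta_one_iff, fun y hy => ?_,
      fun y hy => h.mem_himp_iff hy⟩
    have := h.symm.mem_himp_iff hy
    rwa [Bool.not_not] at this
  | succ k ih =>
    obtain ⟨h1, h2, h3, h4⟩ := ih
    refine ⟨fun y => ?_, fun y => ?_, fun y _ => h1 y, fun y _ => h2 y⟩
    · rw [eval_beta_add_two, mem_himp]
      constructor
      · intro hy hle
        obtain ⟨z1, z2, z3⟩ := (not_le_bc_iff (s := s) (m := n + k)).2 rfl
        rcases hy _ hle ((h2 _).2 z1) with h' | h'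
        · exact (h1 _).1 h' z2
        · exact (h4 _ z2).1 h' z3
      · intro hle z hyz hz
        rw [mem_sup, h1]
        by_contra hn
        push Not at hn
        have hz' := not_imp_not.2 (h4 z hn.1).2 hn.2
        exact hle (hyz.trans (not_le_bc_iff.1 ⟨(h2 z).1 hz, hn.1, not_not.1 hz'⟩).le)
    · rw [eval_gamma_add_two, mem_himp]
      constructor
      · intro hy hle
        obtain ⟨z1, z2, z3⟩ := (not_le_bc_iff (s := !s) (m := n + k)).2 rfl
        rw [Bool.not_not] at z1 z3
        rcases hy _ hle ((h1 _).2 z1) with h' | h'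
        · exact (h2 _).1 h' z2
        · exact (h3 _ z2).1 h' z3
      · intro hle z hyz hz
        rw [mem_sup, h2]
        by_contra hn
        push Not at hn
        have hz' := not_imp_not.2 (h3 z hn.1).2 hn.2
        refine hle (hyz.trans (not_le_bc_iff.1 ⟨?_, hn.1, ?_⟩).le)
        · simpa using (h1 z).1 hz
        · simpa using hz'

theorem IsFinePair.mem_eval_beta (h : IsFinePair (v 0) (v 1) s n) (k : ℕ) {y : FineSpace.{u}} :
    y ∈ (Form.beta (k + 1)).eval v ↔ ¬ y ≤ bc s (n + k + 1) :=
  (h.mem_eval_beta_gamma k).1 y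

theorem IsFinePair.mem_eval_gamma (h : IsFinePair (v 0) (v 1) s n) (k : ℕ) {y : FineSpace.{u}} :
    y ∈ (Form.gamma (k + 1)).eval v ↔ ¬ y ≤ bc (!s) (n + k + 1) :=
  (h.mem_eval_beta_gamma k).2.1 y

theorem IsFinePair.mem_eval_alpha (h : IsFinePair (v 0) (v 1) s n) (k : ℕ) {y : FineSpace.{u}} :
    y ∈ (Form.alpha k).eval v ↔ ¬ y ≤ pa (n + k) := by
  rw [eval_alpha, mem_himp]
  simp only [mem_inf, mem_sup, h.mem_eval_beta, h.mem_eval_gamma]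
  constructor
  · intro hy hle
    obtain ⟨z1, z2, z3, z4⟩ := (eq_pa_iff (s := s) (m := n + k)).2 rfl
    rcases hy _ hle ⟨z1, z2⟩ with h' | h'
    · exact h' z3
    · exact h' z4
  · intro hle z hyz hz
    by_contra hn
    push Not at hn
    exact hle (hyz.trans (eq_pa_iff.1 ⟨hz.1, hz.2, hn⟩).le)

theorem IsFinePair.mem_eval_delta (h : IsFinePair (v 0) (v 1) s n) (k : ℕ) {y : FineSpace.{u}} :
    y ∈ (Form.delta k).eval v ↔ ¬ (y ≤ pa (n + k) ∧ y ≤ pa (n + k + 1)) := by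
  rw [eval_delta, mem_sup, h.mem_eval_alpha, h.mem_eval_alpha, not_and_or, add_assoc]

/-- If `α₀` fails somewhere, then the valuation is in the position of `IsFinePair`. -/
theorem exists_isFinePair_of_notMem_alpha {x : FineSpace.{u}} (hx : x ∉ (Form.alpha 0).eval v) :
    ∃ s n, IsFinePair (v 0) (v 1) s n := by
  rw [eval_alpha, mem_himp] at hx
  push Not at hx
  obtain ⟨y, -, -, hy⟩ := hx
  rw [mem_sup, not_or] at hy
  obtain ⟨hβ, hγ⟩ := hy
  have hβ' : y ∉ (v 0 ⇨ v 1) ⇨ ((v 1 ⇨ v 0) ⊔ v 1) := hβ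
  have hγ' : y ∉ (v 1 ⇨ v 0) ⇨ ((v 0 ⇨ v 1) ⊔ v 0) := hγ
  rw [mem_himp] at hβ' hγ'
  push Not at hβ' hγ'
  obtain ⟨w, -, hw, hw'⟩ := hβ'
  obtain ⟨u, -, hu, hu'⟩ := hγ'
  rw [mem_sup, not_or] at hw' hu'
  exact exists_isFinePair hw hw'.1 hw'.2 hu hu'.1 hu'.2

/-- A counterexample would lie below `aₙ` and `bc s (n + 2)` but not below `aₙ₊₁`. The point `aₙ` is
not below `bc s (n + 2)`, and every `d` below `aₙ` is below `aₙ₊₁`. -/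
theorem eval_kappa_le (v : ℕ → ClopenUpperSet FineSpace.{u}) :
    (Form.alpha 1).eval v ≤ (Form.alpha 0).eval v ⊔ (Form.beta 2).eval v := by
  rw [le_iff]
  intro x hx
  rw [mem_sup]
  by_contra hn
  rw [not_or] at hn
  obtain ⟨s, n, h⟩ := exists_isFinePair_of_notMem_alpha hn.1
  rw [h.mem_eval_alpha, h.mem_eval_beta, not_not, not_not] at hn
  rw [h.mem_eval_alpha] at hx
  obtain ⟨h1, h2⟩ := hn
  rcases eq_cases x with rfl | ⟨m, rfl⟩ | ⟨t, m, rfl⟩ | ⟨m, rfl⟩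
  · exact not_infty_le_pa _ h1
  · rw [pa_le_pa] at h1
    rw [pa_le_bc] at h2
    omega
  · exact not_bc_le_pa _ _ _ h1
  · rw [pd_le_pa] at h1 hx
    omega

theorem eval_alpha_himp_delta_le (v : ℕ → ClopenUpperSet FineSpace.{u}) :
    (Form.alpha 0).eval v ⇨ (Form.delta 1).eval v ≤ (Form.delta 0).eval v := by
  rw [le_iff]
  intro x hx
  by_contra hn
  have hn' := hn
  rw [eval_delta, mem_sup, not_or] at hn'
  obtain ⟨s, n, h⟩ := exists_isFinePair_of_notMem_alpha hn'.1
  rw [h.mem_eval_delta, not_not] at hn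
  obtain ⟨h1, h2⟩ := hn
  rcases eq_cases x with rfl | ⟨m, rfl⟩ | ⟨t, m, rfl⟩ | ⟨m, rfl⟩
  · exact not_infty_le_pa _ h1
  · rw [pa_le_pa] at h1 h2
    omega
  · exact not_bc_le_pa _ _ _ h1
  · rw [pd_le_pa] at h1
    -- `dₙ₊₁` is the `d` of least index not below `aₙ`, so `α₀` holds there; it is below `aₙ₊₁` and
    -- `aₙ₊₂`, so `δ₁` fails.
    have h3 := mem_himp.1 hx (pd (n + 1)) (pd_le_pd.2 (by omega))
      ((h.mem_eval_alpha 0).2 (by rw [pd_le_pa]; omega))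
    rw [h.mem_eval_delta, pd_le_pa, pd_le_pa] at h3
    omega

/-- The clopen upsets `{b₀}` and `{c₀}`. -/
def maxPoint (s : Bool) : ClopenUpperSet FineSpace.{u} where
  carrier := {bc s 0}
  isClopen' := by
    rw [isClopen_iff]
    refine ⟨fun h => (not_bc_le_infty s 0 (Set.mem_singleton_iff.1 h).ge).elim, fun _ => ⟨0, ?_⟩⟩
    intro x hx
    rw [Set.mem_singleton_iff] at hx
    cases s <;> rw [OnePoint.coe_injective hx] <;> exact le_rfl
  upper' := by
    rintro x y hxy rfl
    rcases eq_cases y with rfl | ⟨m, rfl⟩ | ⟨t, m, rfl⟩ | ⟨m, rfl⟩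
    · exact (not_bc_le_infty _ _ hxy).elim
    · exact (not_bc_le_pa _ _ _ hxy).elim
    · rw [bc_le_bc] at hxy
      rw [Set.mem_singleton_iff, bc_inj]
      grind
    · exact (not_bc_le_pd _ _ _ hxy).elim

theorem mem_maxPoint {t : Bool} {x : FineSpace.{u}} : x ∈ maxPoint t ↔ x = bc t 0 :=
  Set.mem_singleton_iff

theorem isFinePair_maxPoint : IsFinePair (maxPoint.{u} false) (maxPoint true) true 0 := by
  constructor
  all_goals simp only [mem_himp, mem_maxPoint, Bool.not_true, bc_inj]
  all_goals first
    | grind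
    | (rintro y hy rfl; simp [bc_le_bc] at hy)

end Eval

end FineSpace

/-! ### `𝔄` as a model of `Sh` refuting `δ₀`, and the conclusion -/

theorem fineAlgebra_mem_shehtmanVariety : fineAlgebra.{u} ∈ shehtmanVariety.{u} := by
  intro φ hφ
  refine Derivable.validates ?_ hφ
  rintro ψ (rfl | rfl | rfl) v
  · exact himp_eq_top_iff.2 (FineSpace.eval_alpha_himp_delta_le v)
  · exact himp_eq_top_iff.2 (FineSpace.eval_kappa_le v)
  · exact himp_eq_top_iff.2 (FineSpace.bb2_le (v 0) (v 1) (v 2))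

theorem not_validates_delta_zero : ¬ fineAlgebra.{u}.Validates (Form.delta 0) := by
  intro h
  -- This sends `p` to `{c₀}` and `q` to `{b₀}`.
  let v : ℕ → ClopenUpperSet FineSpace.{u} := fun n => FineSpace.maxPoint (n == 1)
  have hv : FineSpace.IsFinePair (v 0) (v 1) true 0 := FineSpace.isFinePair_maxPoint
  have h0 : FineSpace.pd 0 ∈ (Form.delta 0).eval v := by
    rw [show (Form.delta 0).eval v = ⊤ from h v]
    trivial
  rw [hv.mem_eval_delta, FineSpace.pd_le_pa, FineSpace.pd_le_pa] at h0
  omega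

end HeytingBrouwer

theorem mainTheorem1 :
    -- the interval `[V(F), V(Sh)]` is an interval
    HeytingBrouwer.fineVariety.{u} ⊆ HeytingBrouwer.shehtmanVariety.{u} ∧
    -- no variety in it is generated by its complete members
    (∀ V : Set HeytingBrouwer.BHAlg.{u}, HeytingBrouwer.IsVariety V →
      V ∈ Set.Icc HeytingBrouwer.fineVariety.{u} HeytingBrouwer.shehtmanVariety.{u} →
      HeytingBrouwer.generatedVariety {B ∈ V | B.IsComplete} ≠ V) ∧
    -- complete algebras in `V(Sh)` validate `δ₀`
    (∀ B ∈ HeytingBrouwer.shehtmanVariety.{u}, B.IsComplete →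
      B.Validates (HeytingBrouwer.Form.delta 0)) ∧
    -- the algebra `𝔄` lies in `V(F)` and refutes `δ₀`
    HeytingBrouwer.fineAlgebra.{u} ∈ HeytingBrouwer.fineVariety.{u} ∧
    ¬ HeytingBrouwer.fineAlgebra.{u}.Validates (HeytingBrouwer.Form.delta 0) := by
  have hmem : HeytingBrouwer.fineAlgebra.{u} ∈ HeytingBrouwer.fineVariety.{u} :=
    fun _ _ h => h rfl
  refine ⟨fun A hA => hA _ (HeytingBrouwer.isVariety_modelsOf _) ?_, fun V _ hI hV => ?_,
    fun B hB hc => HeytingBrouwer.validates_delta_zero hB hc, hmem,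
    HeytingBrouwer.not_validates_delta_zero⟩
  · rintro _ rfl
    exact HeytingBrouwer.fineAlgebra_mem_shehtmanVariety
  -- If `V` were generated by its complete members, the variety of models of `δ₀` would contain `V`,
  -- hence `𝔄`.
  · have h := hI.1 hmem
    rw [← hV] at h
    refine HeytingBrouwer.not_validates_delta_zero (h _
      (HeytingBrouwer.isVariety_modelsOf {HeytingBrouwer.Form.delta 0}) ?_ _ rfl)
    rintro B ⟨hB, hc⟩ φ rfl
    exact HeytingBrouwer.validates_delta_zero (hI.2 hB) hc
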